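/- A *real Laurent polynomial of degree at most $m$* is a function $f(z)=\sum_{k=-m}^{m}a_kz^k$ on $\mathbb C\setminus\{0\}$, $a_k\in\mathbb C$, whose values on the unit circle $S=\{|z|=1\}$ are real. These functions form a finite-dimensional real vector space, with the scalar product $(f,g)=\frac1{2\pi}\int_0^{2\pi}f(e^{i\theta})g(e^{i\theta})\,d\theta$. A *random real Laurent polynomial of degree $m$*, denoted $f_m$, is an element of this space distributed according to the standard normal distribution associated with this scalar product (so its coordinates in any orthonormal basis are independent standard normal variables). A root of $f$ in $\mathbb C\setminus\{0\}$ is called *real* if it lies on $S$. For $m\ge 1$ let $\mathcal P(f_m)$ be the probability that a root of $f_m$ is real, that is, the expectation of the quotient of the number of real roots of $f_m$ by the number of all roots of $f_m$ in $\mathbb C\setminus\{0\}$. Then, whether roots are counted once or with multiplicity: (a) for every $m\ge 0$, the number of real roots of $f_m$ is integrable and its expectation is $2\sqrt{\frac{m(m+1)}{3}}$; (b) for every $m\ge 1$, $\mathcal P(f_m)=\sqrt{\frac{m+1}{3m}}$; (c) $\lim_{m\to\infty}\mathcal P(f_m)=\frac1{\sqrt3}$. -/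

import Mathlib

open scoped LaurentPolynomial

noncomputable section

/-- The value `∑ aₖ zᵏ` of a complex Laurent polynomial at `z` (meaningful for `z ≠ 0`). -/
def laurentEval (f : ℂ[T;T⁻¹]) (z : ℂ) : ℂ :=
  f.coeff.sum fun k a => a * z ^ k

theorem laurentEval_add (f g : ℂ[T;T⁻¹]) (z : ℂ) :
    laurentEval (f + g) z = laurentEval f z + laurentEval g z := by
  unfold laurentEval
  rw [AddMonoidAlgebra.coeff_add]
  exact Finsupp.sum_add_index' (by simp) (by intros; ring)

theorem laurentEval_zero (z : ℂ) : laurentEval 0 z = 0 := by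
  simp [laurentEval]

theorem laurentEval_smul (c : ℝ) (f : ℂ[T;T⁻¹]) (z : ℂ) :
    laurentEval (c • f) z = c * laurentEval f z := by
  unfold laurentEval
  rw [AddMonoidAlgebra.coeff_smul, Finsupp.sum_smul_index' (by simp), Finsupp.mul_sum]
  simp [mul_assoc]

theorem laurentEval_unit (f : ℂ[T;T⁻¹]) (u : ℂˣ) :
    laurentEval f u = LaurentPolynomial.eval₂ (RingHom.id ℂ) u f := by
  induction f using LaurentPolynomial.induction_on' with
  | add p q hp hq => rw [laurentEval_add, map_add, hp, hq]
  | C_mul_T n a =>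
    rw [LaurentPolynomial.eval₂_C_mul_T, ← LaurentPolynomial.single_eq_C_mul_T,
      laurentEval, AddMonoidAlgebra.coeff_single, Finsupp.sum_single_index (zero_mul _)]
    simp

/-- A Laurent polynomial that vanishes on an arc of the unit circle is zero. -/
theorem eq_zero_of_laurentEval_circle (f : ℂ[T;T⁻¹])
    (h : ∀ θ ∈ Set.Ioc (0 : ℝ) 1, laurentEval f (Complex.exp (θ * Complex.I)) = 0) : f = 0 := by
  obtain ⟨n, p, hp⟩ := LaurentPolynomial.exists_T_pow f
  have hp0 : p = 0 := by
    refine Polynomial.eq_zero_of_infinite_isRoot p ?_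
    refine Set.Infinite.mono (s := (fun x : ℝ => Complex.exp (x * Complex.I)) '' Set.Ioc 0 1) ?_ ?_
    · rintro _ ⟨x, hx, rfl⟩
      have hu := laurentEval_unit f (Units.mk0 _ (Complex.exp_ne_zero (x * Complex.I)))
      have h1 := congrArg (LaurentPolynomial.eval₂ (RingHom.id ℂ)
        (Units.mk0 _ (Complex.exp_ne_zero (x * Complex.I)))) hp
      rw [map_mul, ← hu, Units.val_mk0, h x hx, zero_mul, LaurentPolynomial.eval₂_toLaurent] at h1
      simpa [Polynomial.IsRoot, Polynomial.eval₂_id] using h1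
    · refine (Set.Ioc_infinite (zero_lt_one' ℝ)).image ?_
      intro x hx y hy hxy
      have hxy' : Complex.exp (x * Complex.I) = Complex.exp (y * Complex.I) := hxy
      have hpi := Real.pi_gt_three
      have hx' : (x * Complex.I : ℂ).im = x := by simp
      have hy' : (y * Complex.I : ℂ).im = y := by simp
      have := Complex.exp_inj_of_neg_pi_lt_of_le_pi (x := x * Complex.I) (y := y * Complex.I)
        (by rw [hx']; linarith [hx.1]) (by rw [hx']; linarith [hx.2])
        (by rw [hy']; linarith [hy.1]) (by rw [hy']; linarith [hy.2]) hxy'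
      rw [← hx', ← hy', this]
  rw [hp0, map_zero] at hp
  have hT : (LaurentPolynomial.T n * LaurentPolynomial.T (-n) : ℂ[T;T⁻¹]) = 1 := by
    rw [← LaurentPolynomial.T_add, add_neg_cancel, LaurentPolynomial.T_zero]
  rw [← mul_one f, ← hT, ← mul_assoc, ← hp, zero_mul]

theorem continuous_laurentEval_circle (f : ℂ[T;T⁻¹]) :
    Continuous fun θ : ℝ => laurentEval f (Complex.exp (θ * Complex.I)) := by
  unfold laurentEval Finsupp.sum
  refine continuous_finsetSum _ fun k _ => continuous_const.mul ?_
  exact Continuous.zpow₀ (by fun_prop) k fun θ => Or.inl (Complex.exp_ne_zero _)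

/-- The real vector space of real Laurent polynomials of degree at most `m`: those with
spectrum in `{-m, …, m}` whose values on the unit circle are real. -/
def realLaurent (m : ℕ) : Submodule ℝ ℂ[T;T⁻¹] where
  carrier := {f | (∀ k ∈ f.coeff.support, |k| ≤ (m : ℤ)) ∧
    ∀ z : ℂ, ‖z‖ = 1 → (laurentEval f z).im = 0}
  zero_mem' := by simp [laurentEval_zero]
  add_mem' := by
    rintro f g ⟨hf, hf'⟩ ⟨hg, hg'⟩
    refine ⟨fun k hk => ?_, fun z hz => by simp [laurentEval_add, hf' z hz, hg' z hz]⟩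
    rw [AddMonoidAlgebra.coeff_add] at hk
    rcases Finset.mem_union.1 (Finsupp.support_add hk) with h | h
    exacts [hf k h, hg k h]
  smul_mem' := by
    rintro c f ⟨hf, hf'⟩
    refine ⟨fun k hk => ?_, fun z hz => by simp [laurentEval_smul, hf' z hz]⟩
    rw [AddMonoidAlgebra.coeff_smul] at hk
    exact hf k (Finsupp.support_smul hk)

namespace realLaurent

/-- The restriction of a real Laurent polynomial to the unit circle, as a real function of the
angle (a trigonometric polynomial). -/
def trig {m : ℕ} (f : realLaurent m) (θ : ℝ) : ℝ :=
  (laurentEval f (Complex.exp (θ * Complex.I))).re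

theorem continuous_trig {m : ℕ} (f : realLaurent m) : Continuous (trig f) :=
  Complex.continuous_re.comp (continuous_laurentEval_circle f)

/-- The scalar product of `L₂` of the circle, `(f, g) = (1 / 2π) ∫ f g dθ`. -/
@[reducible]
def innerCore (m : ℕ) : InnerProductSpace.Core ℝ (realLaurent m) where
  inner f g := (1 / (2 * Real.pi)) * ∫ θ in (0 : ℝ)..2 * Real.pi, trig f θ * trig g θ
  conj_inner_symm f g := by simp [mul_comm]
  re_inner_nonneg f := by
    have : 0 ≤ ∫ θ in (0 : ℝ)..2 * Real.pi, trig f θ * trig f θ :=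
      intervalIntegral.integral_nonneg (by positivity) fun _ _ => mul_self_nonneg _
    simp only [RCLike.re_to_real]
    positivity
  add_left f g h := by
    rw [← mul_add, ← intervalIntegral.integral_add]
    · simp [trig, laurentEval_add, add_mul]
    · exact ((continuous_trig f).mul (continuous_trig h)).intervalIntegrable _ _
    · exact ((continuous_trig g).mul (continuous_trig h)).intervalIntegrable _ _
  smul_left f g c := by
    simp only [trig, Submodule.coe_smul, laurentEval_smul, Complex.re_ofReal_mul, mul_assoc,
      intervalIntegral.integral_const_mul, conj_trivial]
    ring
  definite f hf := by
    have hpi := Real.pi_pos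
    have h0 : ∫ θ in (0 : ℝ)..2 * Real.pi, trig f θ * trig f θ = 0 := by
      rcases mul_eq_zero.1 hf with h | h
      · exact absurd h (by positivity)
      · exact h
    have hc : Continuous fun θ => trig f θ * trig f θ :=
      (continuous_trig f).mul (continuous_trig f)
    have hz : ∀ θ ∈ Set.Ico 0 (2 * Real.pi), trig f θ = 0 := by
      intro θ hθ
      by_contra hne
      have : 0 < ∫ θ in (0 : ℝ)..2 * Real.pi, trig f θ * trig f θ :=
        intervalIntegral.integral_pos (by positivity) hc.continuousOn
          (fun _ _ => mul_self_nonneg _) ⟨θ, ⟨hθ.1, hθ.2.le⟩, mul_self_pos.2 hne⟩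
      linarith
    refine Subtype.ext (eq_zero_of_laurentEval_circle f fun θ hθ => Complex.ext ?_ ?_)
    · exact hz θ ⟨hθ.1.le, by linarith [hθ.2, Real.pi_gt_three]⟩
    · exact f.2.2 _ (Complex.norm_exp_ofReal_mul_I θ)

instance (m : ℕ) : NormedAddCommGroup (realLaurent m) := (innerCore m).toNormedAddCommGroup

instance (m : ℕ) : InnerProductSpace ℝ (realLaurent m) := .ofCore (innerCore m).toCore

instance (m : ℕ) : FiniteDimensional ℝ (realLaurent m) := by
  let φ : realLaurent m →ₗ[ℝ] (Finset.Icc (-(m : ℤ)) m → ℂ) :=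
    { toFun := fun f k => f.1.coeff k
      map_add' := fun f g => by ext k; simp
      map_smul' := fun c f => by ext k; simp }
  refine FiniteDimensional.of_injective φ fun f g hfg => ?_
  apply Subtype.ext
  apply AddMonoidAlgebra.coeff_injective
  ext1 k
  by_cases hk : k ∈ Finset.Icc (-(m : ℤ)) m
  · exact congrFun hfg ⟨k, hk⟩
  · have h : ∀ f : realLaurent m, f.1.coeff k = 0 := fun f => by
      by_contra hne
      exact hk (Finset.mem_Icc.2 (abs_le.1 (f.2.1 k (Finsupp.mem_support_iff.2 hne))))
    rw [h f, h g]

instance (m : ℕ) : MeasurableSpace (realLaurent m) := borel _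

instance (m : ℕ) : BorelSpace (realLaurent m) := ⟨rfl⟩

end realLaurent

/-- The law of a random real Laurent polynomial of degree `m`: the standard normal distribution
for the `L₂` scalar product. -/
abbrev randomLaurent (m : ℕ) : MeasureTheory.Measure (realLaurent m) :=
  ProbabilityTheory.stdGaussian (realLaurent m)

/-- The roots of a Laurent polynomial in `ℂ ∖ 0`. -/
def laurentRoots (f : ℂ[T;T⁻¹]) : Set ℂ := {z | z ≠ 0 ∧ laurentEval f z = 0}

/-- The roots on the unit circle, called the real roots. -/
def laurentRealRoots (f : ℂ[T;T⁻¹]) : Set ℂ := {z ∈ laurentRoots f | ‖z‖ = 1}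

/-- The two usual ways to count roots. -/
inductive RootCounting
  | distinct
  | withMultiplicity

/-- The number of elements of a set `R` of roots of `f`, each one counted once or with its
multiplicity as a zero of `f`. Both are `0` by convention for an infinite set `R`, which occurs
only for `f = 0`. -/
def countRoots (f : ℂ[T;T⁻¹]) (R : Set ℂ) : RootCounting → ℕ
  | .distinct => R.ncard
  | .withMultiplicity => ∑ᶠ z ∈ R, analyticOrderNatAt (laurentEval f) z

/-- The probability that a root of a random real Laurent polynomial of degree `m` is real: the
mean of the probability that a root of `f`, chosen uniformly among all roots of `f`, is real. -/
def realRootProbability (m : ℕ) (c : RootCounting) : ℝ :=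
  ∫ f : realLaurent m, (countRoots f (laurentRealRoots f) c : ℝ) / countRoots f (laurentRoots f) c
    ∂randomLaurent m

end

/-!
For every angle `θ`, the value `f(eⁱᶿ)` is the scalar product of `f` with the Dirichlet kernel
`K_θ`, so the real roots of `f` are the angles at which the curve `θ ↦ K_θ` crosses the
hyperplane orthogonal to `f`. The curve lies on a sphere of radius `r = √(2m + 1)` and has
constant speed `√(m(m + 1)(2m + 1) / 3)`. The expected number of crossings with a Gaussian
hyperplane is the length of the curve divided by `π r`. To see this, resample the coordinate of
`f` along the constant `1`: since `⟨1, K_θ⟩ = 1`, the zeros of `f + a` are the fibre over `-a`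
of `θ ↦ ⟨f, K_θ⟩`, and the area formula counts these fibres.

Almost surely the extreme coefficients of `f` do not vanish and all roots are simple, because
`f + a` has a multiple root only when `-a` is one of the finitely many critical values of `f`.
Then `f` has exactly `2m` roots, and the two ways of counting agree.
-/

open MeasureTheory ProbabilityTheory Set Topology ComplexConjugate
open scoped ENNReal NNReal Function

section AreaFormula

theorem encard_iUnion_inter_preimage_singleton {ι α β : Type*} [Countable ι] {f : α → β}
    {t : ι → Set α} (hd : Pairwise (Disjoint on t)) (hi : ∀ i, InjOn f (t i)) (y : β) :
    (((⋃ i, t i) ∩ f ⁻¹' {y}).encard : ℝ≥0∞) = ∑' i, (f '' t i).indicator 1 y := by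
  let _ : MeasurableSpace α := ⊤
  rw [iUnion_inter, ← Measure.count_apply .of_discrete, measure_iUnion
    (fun i j hij => (hd hij).mono inter_subset_left inter_subset_left) fun _ => .of_discrete]
  refine tsum_congr fun i => ?_
  rw [Measure.count_apply .of_discrete]
  by_cases hy : y ∈ f '' t i
  · rw [indicator_of_mem hy]
    obtain ⟨x, hx, rfl⟩ := hy
    have : t i ∩ f ⁻¹' {f x} = {x} :=
      Subset.antisymm (fun z hz => hi i hz.1 hx hz.2) (singleton_subset_iff.2 ⟨hx, rfl⟩)
    simp [this]
  · have : t i ∩ f ⁻¹' {y} = ∅ := eq_empty_of_forall_notMem fun z hz => hy ⟨z, hz⟩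
    simp [this, indicator_of_notMem hy]

variable {E : Type*} [NormedAddCommGroup E] [NormedSpace ℝ E] [FiniteDimensional ℝ E]

theorem exists_pos_forall_approximatesLinearOn_injOn {A : E →L[ℝ] E} (hA : A.det ≠ 0) :
    ∃ r : ℝ≥0, r ≠ 0 ∧ ∀ (f : E → E) (t : Set E), ApproximatesLinearOn f A t r → InjOn f t := by
  obtain ⟨r, hr, hrA⟩ : ∃ r : ℝ≥0, r ≠ 0 ∧ (Subsingleton E ∨
      r < ‖((A.toContinuousLinearEquivOfDetNeZero hA).symm : E →L[ℝ] E)‖₊⁻¹) := by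
    rcases (A.toContinuousLinearEquivOfDetNeZero hA).subsingleton_or_nnnorm_symm_pos with h | h
    · exact ⟨1, one_ne_zero, .inl h⟩
    · obtain ⟨r, hr0, hr⟩ := exists_between (inv_pos.2 h)
      exact ⟨r, hr0.ne', .inr hr⟩
  exact ⟨r, hr, fun f t h => ApproximatesLinearOn.injOn
    (f' := A.toContinuousLinearEquivOfDetNeZero hA) (by simpa using h) hrA⟩

variable [MeasurableSpace E] [BorelSpace E] (μ : Measure E) [μ.IsAddHaarMeasure]
  {s : Set E} {f : E → E} {f' : E → E →L[ℝ] E} {φ : E → ℝ≥0∞}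

theorem exists_partition_injOn_of_det_ne_zero (hs : MeasurableSet s)
    (hf : ∀ x ∈ s, HasFDerivWithinAt f (f' x) s x) (hdet : ∀ x ∈ s, (f' x).det ≠ 0) :
    ∃ t : ℕ → Set E, (∀ n, MeasurableSet (t n)) ∧ Pairwise (Disjoint on t) ∧
      (∀ n, InjOn f (t n)) ∧ ⋃ n, t n = s := by
  have hr (A : E →L[ℝ] E) : ∃ r : ℝ≥0, r ≠ 0 ∧ (A.det ≠ 0 → ∀ (f : E → E) (t : Set E),
      ApproximatesLinearOn f A t r → InjOn f t) := by
    by_cases hA : A.det = 0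
    · exact ⟨1, one_ne_zero, fun h => absurd hA h⟩
    · obtain ⟨r, hr, hinj⟩ := exists_pos_forall_approximatesLinearOn_injOn hA
      exact ⟨r, hr, fun _ => hinj⟩
  choose r hr0 hrinj using hr
  obtain ⟨t, A, htd, htm, hst, happ, hA⟩ :=
    exists_partition_approximatesLinearOn_of_hasFDerivWithinAt f s f' hf r hr0
  refine ⟨fun n => s ∩ t n, fun n => hs.inter (htm n),
    fun i j hij => (htd hij).mono inter_subset_right inter_subset_right, fun n => ?_,
    by rw [← inter_iUnion, inter_eq_left.2 hst]⟩
  rcases s.eq_empty_or_nonempty with rfl | hne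
  · simp
  · obtain ⟨y, hy, hAy⟩ := hA hne n
    exact hrinj (A n) (hAy ▸ hdet y hy) f _ (happ n)

theorem lintegral_encard_fiber_mul_of_det_ne_zero (hs : MeasurableSet s)
    (hf : ∀ x ∈ s, HasFDerivWithinAt f (f' x) s x) (hdet : ∀ x ∈ s, (f' x).det ≠ 0)
    (hφ : Measurable φ) :
    ∫⁻ y, ((s ∩ f ⁻¹' {y}).encard : ℝ≥0∞) * φ y ∂μ =
      ∫⁻ x in s, ENNReal.ofReal |(f' x).det| * φ (f x) ∂μ := by
  obtain ⟨t, htm, htd, hti, rfl⟩ := exists_partition_injOn_of_det_ne_zero hs hf hdet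
  have hft (n) : ∀ x ∈ t n, HasFDerivWithinAt f (f' x) (t n) x := fun x hx =>
    (hf x (mem_iUnion_of_mem n hx)).mono (subset_iUnion t n)
  have him (n) : MeasurableSet (f '' t n) :=
    measurable_image_of_fderivWithin (htm n) (hft n) (hti n)
  calc ∫⁻ y, (((⋃ n, t n) ∩ f ⁻¹' {y}).encard : ℝ≥0∞) * φ y ∂μ
      = ∫⁻ y, ∑' n, (f '' t n).indicator φ y ∂μ := by
        simp_rw [encard_iUnion_inter_preimage_singleton htd hti, ← ENNReal.tsum_mul_right,
          ← indicator_mul_left, Pi.one_apply, one_mul]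
    _ = ∑' n, ∫⁻ x in t n, ENNReal.ofReal |(f' x).det| * φ (f x) ∂μ := by
        rw [lintegral_tsum fun n => (hφ.indicator (him n)).aemeasurable]
        refine tsum_congr fun n => ?_
        rw [lintegral_indicator (him n),
          lintegral_image_eq_lintegral_abs_det_fderiv_mul μ (htm n) (hft n) (hti n)]
    _ = ∫⁻ x in ⋃ n, t n, ENNReal.ofReal |(f' x).det| * φ (f x) ∂μ :=
        (lintegral_iUnion htm htd _).symm

theorem lintegral_encard_fiber_mul (hs : MeasurableSet s)
    (hf : ∀ x ∈ s, HasFDerivWithinAt f (f' x) s x) (hf' : Measurable fun x => (f' x).det)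
    (hφ : Measurable φ) :
    ∫⁻ y, ((s ∩ f ⁻¹' {y}).encard : ℝ≥0∞) * φ y ∂μ =
      ∫⁻ x in s, ENNReal.ofReal |(f' x).det| * φ (f x) ∂μ := by
  set r : Set E := {x | (f' x).det ≠ 0}
  have hr : MeasurableSet r := hf' (measurableSet_singleton 0).compl
  have hcrit : μ (f '' (s \ r)) = 0 :=
    addHaar_image_eq_zero_of_det_fderivWithin_eq_zero μ
      (fun x hx => (hf x hx.1).mono sdiff_subset) fun x hx => not_not.1 hx.2
  calc ∫⁻ y, ((s ∩ f ⁻¹' {y}).encard : ℝ≥0∞) * φ y ∂μ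
      = ∫⁻ y, ((s ∩ r ∩ f ⁻¹' {y}).encard : ℝ≥0∞) * φ y ∂μ := by
        refine lintegral_congr_ae ?_
        filter_upwards [compl_mem_ae_iff.2 hcrit] with y hy
        have : s ∩ f ⁻¹' {y} = s ∩ r ∩ f ⁻¹' {y} := by
          ext x
          have : x ∈ s → f x = y → x ∈ r := fun hx hxy => by_contra fun h => hy ⟨x, ⟨hx, h⟩, hxy⟩
          simp only [mem_inter_iff, mem_preimage, mem_singleton_iff]
          tauto
        rw [this]
    _ = ∫⁻ x in s ∩ r, ENNReal.ofReal |(f' x).det| * φ (f x) ∂μ :=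
        lintegral_encard_fiber_mul_of_det_ne_zero μ (hs.inter hr)
          (fun x hx => (hf x hx.1).mono inter_subset_left) (fun x hx => hx.2) hφ
    _ = ∫⁻ x in s, ENNReal.ofReal |(f' x).det| * φ (f x) ∂μ := by
        rw [← lintegral_inter_add_sdiff _ s hr, setLIntegral_eq_zero (hs.diff hr) fun x hx => by
          simp [not_not.1 hx.2], add_zero]

theorem lintegral_encard_fiber_mul_of_hasDerivWithinAt {s : Set ℝ} {g g' : ℝ → ℝ} {φ : ℝ → ℝ≥0∞}
    (hs : MeasurableSet s) (hg : ∀ x ∈ s, HasDerivWithinAt g (g' x) s x) (hg' : Measurable g')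
    (hφ : Measurable φ) :
    ∫⁻ y, ((s ∩ g ⁻¹' {y}).encard : ℝ≥0∞) * φ y =
      ∫⁻ x in s, ENNReal.ofReal |g' x| * φ (g x) := by
  have hdet (x : ℝ) : (ContinuousLinearMap.toSpanSingleton ℝ (g' x)).det = g' x := by
    simp [ContinuousLinearMap.det]
  simpa only [hdet] using lintegral_encard_fiber_mul volume hs
    (fun x hx => (hg x hx).hasFDerivWithinAt) (by simpa only [hdet] using hg') hφ

end AreaFormula

section ZeroCount

theorem isSigmaCompact_of_isLocallyClosed {Y : Type*} [TopologicalSpace Y] [LocallyCompactSpace Y]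
    [SecondCountableTopology Y] {s : Set Y} (hs : IsLocallyClosed s) : IsSigmaCompact s := by
  have := hs.locallyCompactSpace
  exact isSigmaCompact_iff_sigmaCompactSpace.2 inferInstance

theorem isClosed_setOf_exists_mem_isCompact {X Y Z : Type*} [TopologicalSpace X]
    [TopologicalSpace Y] [TopologicalSpace Z] [T1Space Z] {F : X → Y → Z} {K : Set Y}
    (hK : IsCompact K) (hF : ContinuousOn (fun p : X × Y => F p.1 p.2) (univ ×ˢ K)) (z : Z) :
    IsClosed {x | ∃ y ∈ K, F x y = z} := by
  have : CompactSpace K := isCompact_iff_compactSpace.1 hK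
  have hc : Continuous fun p : K × X => F p.2 p.1 :=
    hF.comp_continuous (f := fun p : K × X => (p.2, (p.1 : Y))) (by fun_prop)
      fun p => ⟨mem_univ _, p.1.2⟩
  convert isClosedMap_snd_of_compactSpace _ (isClosed_singleton.preimage hc (t := {z})) using 1
  ext x
  simp

variable {X Y Z : Type*} [TopologicalSpace X] [MeasurableSpace X] [OpensMeasurableSpace X]

theorem measurableSet_setOf_exists_mem_isSigmaCompact [TopologicalSpace Y] [TopologicalSpace Z]
    [T1Space Z] {F : X → Y → Z} {s : Set Y} (hs : IsSigmaCompact s)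
    (hF : ContinuousOn (fun p : X × Y => F p.1 p.2) (univ ×ˢ s)) (z : Z) :
    MeasurableSet {x | ∃ y ∈ s, F x y = z} := by
  obtain ⟨K, hK, rfl⟩ := hs
  have : {x | ∃ y ∈ ⋃ n, K n, F x y = z} = ⋃ n, {x | ∃ y ∈ K n, F x y = z} := by
    ext x
    simp only [mem_iUnion, mem_ofPred_eq]
    tauto
  rw [this]
  exact .iUnion fun n => (isClosed_setOf_exists_mem_isCompact (hK n)
    (hF.mono (prod_mono_right (subset_iUnion K n))) z).measurableSet

theorem exists_injOn_floor_mul {t : Set ℝ} (ht : t.Finite) :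
    ∃ n : ℕ, InjOn (fun x : ℝ => ⌊x * n⌋) t := by
  have hsep : ∀ p ∈ t ×ˢ t, ∀ᶠ n : ℕ in Filter.atTop, p.1 < p.2 → 1 ≤ (p.2 - p.1) * n := by
    intro p _
    by_cases hp : p.1 < p.2
    · filter_upwards [(tendsto_natCast_atTop_atTop (R := ℝ)).const_mul_atTop
        (sub_pos.2 hp) |>.eventually_ge_atTop 1] with n hn _ using hn
    · exact .of_forall fun n h => absurd h hp
  obtain ⟨n, hn⟩ := ((ht.prod ht).eventually_all.2 hsep).exists
  have hmono : StrictMonoOn (fun x : ℝ => ⌊x * n⌋) t := by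
    intro x hx y hy hxy
    have hstep : x * n + 1 ≤ y * n := by linarith [hn (x, y) ⟨hx, hy⟩ hxy]
    exact Int.lt_iff_add_one_le.2 (Int.floor_add_one (x * n) ▸ Int.floor_le_floor hstep)
  exact ⟨n, hmono.injOn⟩

theorem encard_eq_iSup_encard_image_floor (S : Set ℝ) :
    S.encard = ⨆ n : ℕ, ((fun x : ℝ => ⌊x * n⌋) '' S).encard := by
  refine le_antisymm (ENat.forall_natCast_le_iff_le.1 fun k hk => ?_)
    (iSup_le fun n => encard_image_le _ _)
  obtain ⟨t, htS, htk⟩ := exists_subset_encard_eq hk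
  obtain ⟨n, hn⟩ := exists_injOn_floor_mul (finite_of_encard_eq_coe htk)
  calc (k : ℕ∞) = ((fun x : ℝ => ⌊x * n⌋) '' t).encard := by rw [hn.encard_image, htk]
    _ ≤ ((fun x : ℝ => ⌊x * n⌋) '' S).encard := encard_le_encard (image_mono htS)
    _ ≤ _ := le_iSup (fun n : ℕ => ((fun x : ℝ => ⌊x * n⌋) '' S).encard) n

theorem measurable_encard_of_countable {α ι : Type*} [MeasurableSpace α] [Countable ι]
    {S : α → Set ι} (hS : ∀ i, MeasurableSet {x | i ∈ S x}) :
    Measurable fun x => ((S x).encard : ℝ≥0∞) := by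
  have hsum (x : α) : ((S x).encard : ℝ≥0∞) = ∑' i, {x | i ∈ S x}.indicator 1 x := by
    rw [← ENNReal.tsum_set_one]
    exact tsum_subtype (S x) fun _ => 1
  simp_rw [hsum]
  exact .tsum fun i => measurable_one.indicator (hS i)

theorem isLocallyClosed_setOf_floor_mul_eq (c : ℝ) (k : ℤ) :
    IsLocallyClosed {x : ℝ | ⌊x * c⌋ = k} := by
  have : {x : ℝ | ⌊x * c⌋ = k} = (fun x => x * c) ⁻¹' Ico (k : ℝ) (k + 1) := by
    ext x
    exact Int.floor_eq_iff
  rw [this]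
  exact isLocallyClosed_Ico.preimage (by fun_prop)

theorem measurable_encard_zeros {F : X → ℝ → ℝ} (hF : Continuous fun p : X × ℝ => F p.1 p.2)
    {s : Set ℝ} (hs : IsLocallyClosed s) :
    Measurable fun x => ({θ ∈ s | F x θ = 0}.encard : ℝ≥0∞) := by
  simp_rw [encard_eq_iSup_encard_image_floor, ENat.toENNReal_iSup]
  refine .iSup fun n => measurable_encard_of_countable fun k => ?_
  have hcell : {x | k ∈ (fun θ : ℝ => ⌊θ * n⌋) '' {θ ∈ s | F x θ = 0}} =
      {x | ∃ θ ∈ s ∩ {θ | ⌊θ * n⌋ = k}, F x θ = 0} := by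
    ext x
    simp only [mem_image, mem_ofPred_eq, mem_inter_iff]
    grind
  rw [hcell]
  exact measurableSet_setOf_exists_mem_isSigmaCompact (isSigmaCompact_of_isLocallyClosed
    (hs.inter (isLocallyClosed_setOf_floor_mul_eq n k))) hF.continuousOn 0

end ZeroCount

section Gaussian

theorem lintegral_ofReal_abs_gaussianReal (v : ℝ≥0) :
    ∫⁻ x, ENNReal.ofReal |x| ∂(gaussianReal 0 v) = ENNReal.ofReal √(2 * v / Real.pi) := by
  rcases eq_zero_or_pos v with rfl | hv
  · simp
  have _ : (0 : ℝ) < v := hv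
  have hint : Integrable (fun x : ℝ => |x|) (gaussianReal 0 v) := IsGaussian.integrable_id.abs
  have hdensity (x : ℝ) : gaussianPDFReal 0 v x * |x| =
      (fun y => (√(2 * Real.pi * v))⁻¹ *
        (y ^ (1 : ℝ) * Real.exp (-(1 / (2 * v)) * y ^ (2 : ℝ)))) |x| := by
    simp only [gaussianPDFReal, sub_zero, Real.rpow_one, Real.rpow_two, sq_abs]
    ring_nf
  rw [← ofReal_integral_eq_lintegral_ofReal hint (.of_forall fun x => abs_nonneg x),
    integral_gaussianReal_eq_integral_smul hv.ne']
  simp_rw [smul_eq_mul, hdensity]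
  rw [integral_comp_abs (f := fun y => _ * (y ^ (1 : ℝ) * Real.exp (-(1 / (2 * v)) * y ^ (2 : ℝ)))),
    integral_const_mul,
    integral_rpow_mul_exp_neg_mul_rpow (by norm_num) (by norm_num) (by positivity)]
  rw [show (-(1 + 1) / 2 : ℝ) = -1 by norm_num, show ((1 + 1) / 2 : ℝ) = 1 by norm_num,
    Real.Gamma_one, Real.rpow_neg_one]
  congr 1
  refine (Real.sqrt_eq_iff_mul_self_eq_of_pos (by positivity)).2 ?_ |>.symm
  field_simp
  rw [Real.sq_sqrt (by positivity)]

theorem gaussianPDFReal_self (μ : ℝ) (v : ℝ≥0) :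
    gaussianPDFReal μ v μ = (√(2 * Real.pi * v))⁻¹ := by
  simp [gaussianPDFReal]

theorem lintegral_gaussianPDF_gaussianReal {v : ℝ≥0} (hv : v ≠ 0) (w : ℝ≥0) :
    ∫⁻ x, gaussianPDF 0 v x ∂(gaussianReal 0 w) = gaussianPDF 0 (v + w) 0 := by
  rcases eq_or_ne w 0 with rfl | hw
  · simp [lintegral_dirac' _ (measurable_gaussianPDF 0 v)]
  have _ : (0 : ℝ) < v := NNReal.coe_pos.2 (pos_iff_ne_zero.2 hv)
  have _ : (0 : ℝ) < w := NNReal.coe_pos.2 (pos_iff_ne_zero.2 hw)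
  have hmul (x : ℝ) : gaussianPDF 0 w x * gaussianPDF 0 v x =
      ENNReal.ofReal ((√(2 * Real.pi * w))⁻¹ * (√(2 * Real.pi * v))⁻¹ *
        Real.exp (-((v + w) / (2 * v * w)) * x ^ 2)) := by
    have hexp : -((v + w) / (2 * v * w)) * x ^ 2 = -x ^ 2 / (2 * w) + -x ^ 2 / (2 * v) := by
      field_simp
      ring
    rw [gaussianPDF, gaussianPDF, ← ENNReal.ofReal_mul (gaussianPDFReal_nonneg _ _ _), hexp,
      Real.exp_add, gaussianPDFReal, gaussianPDFReal, sub_zero]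
    ring_nf
  have hint : Integrable fun x : ℝ => Real.exp (-((v + w) / (2 * v * w) : ℝ) * x ^ 2) :=
    integrable_exp_neg_mul_sq (by positivity)
  rw [gaussianReal_of_var_ne_zero _ hw, lintegral_withDensity_eq_lintegral_mul _
    (measurable_gaussianPDF _ _) (measurable_gaussianPDF _ _)]
  simp_rw [Pi.mul_apply, hmul]
  rw [← ofReal_integral_eq_lintegral_ofReal (hint.const_mul _) (.of_forall fun x => by positivity),
    integral_const_mul, integral_gaussian, gaussianPDF, gaussianPDFReal_self,
    ← Real.sqrt_inv, ← Real.sqrt_inv, ← Real.sqrt_inv, ← Real.sqrt_mul (by positivity),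
    ← Real.sqrt_mul (by positivity), NNReal.coe_add]
  congr 2
  field_simp

theorem lintegral_encard_fiber_gaussianReal {g : ℝ → ℝ} (hg : Differentiable ℝ g) {s : Set ℝ}
    (hs : MeasurableSet s) (μ : ℝ) {v : ℝ≥0} (hv : v ≠ 0) :
    ∫⁻ a, ((s ∩ g ⁻¹' {a}).encard : ℝ≥0∞) ∂(gaussianReal μ v) =
      ∫⁻ θ in s, ENNReal.ofReal |deriv g θ| * gaussianPDF μ v (g θ) := by
  rw [← lintegral_encard_fiber_mul_of_hasDerivWithinAt hs
      (fun θ _ => (hg θ).hasDerivAt.hasDerivWithinAt) (measurable_deriv g)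
      (measurable_gaussianPDF μ v),
    gaussianReal_of_var_ne_zero _ hv, lintegral_withDensity_eq_lintegral_mul_non_measurable _
      (measurable_gaussianPDF μ v) (.of_forall fun _ => gaussianPDF_lt_top)]
  simp_rw [Pi.mul_apply, mul_comm]

variable {E : Type*} [NormedAddCommGroup E] [InnerProductSpace ℝ E]
  {γ : ℝ → E} {e : E} {r : ℝ}

theorem inner_deriv_eq_zero_of_norm_eq (hγ : Differentiable ℝ γ) (hr : ∀ θ, ‖γ θ‖ = r) (θ : ℝ) :
    inner ℝ (γ θ) (deriv γ θ) = 0 := by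
  have h := (hγ θ).hasDerivAt.norm_sq
  simp only [hr] at h
  linarith [h.unique (hasDerivAt_const θ (r ^ 2))]

theorem lintegral_encard_zeros_inner_resample (hγ : Differentiable ℝ γ)
    (heγ : ∀ θ, inner ℝ e (γ θ) = 1) {s : Set ℝ} (hs : MeasurableSet s) (f : E) :
    ∫⁻ a, ({θ ∈ s | inner ℝ (a • e + (f - inner ℝ e f • e)) (γ θ) = 0}.encard : ℝ≥0∞)
        ∂(gaussianReal 0 1) =
      ∫⁻ θ in s, ENNReal.ofReal |inner ℝ f (deriv γ θ)| *
        gaussianPDF 0 1 (inner ℝ f (e - γ θ)) := by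
  have hderiv (θ : ℝ) :
      HasDerivAt (fun θ => inner ℝ f (e - γ θ)) (-inner ℝ f (deriv γ θ)) θ := by
    simpa using (hasDerivAt_const θ f).inner ℝ ((hγ θ).hasDerivAt.const_sub e)
  have hzeros (a : ℝ) : {θ ∈ s | inner ℝ (a • e + (f - inner ℝ e f • e)) (γ θ) = 0} =
      s ∩ (fun θ => inner ℝ f (e - γ θ)) ⁻¹' {a} := by
    ext θ
    have : inner ℝ (a • e + (f - inner ℝ e f • e)) (γ θ) = a - inner ℝ f (e - γ θ) := by
      simp only [inner_add_left, inner_sub_left, inner_sub_right, real_inner_smul_left, heγ θ,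
        real_inner_comm e f]
      ring
    simp only [this, sub_eq_zero, eq_comm (a := a), mem_ofPred_eq, mem_inter_iff, mem_preimage,
      mem_singleton_iff]
  simp_rw [hzeros]
  rw [lintegral_encard_fiber_gaussianReal (fun θ => (hderiv θ).differentiableAt) hs 0 one_ne_zero]
  simp_rw [(hderiv _).deriv, abs_neg]

variable [FiniteDimensional ℝ E] [MeasurableSpace E] [BorelSpace E]

theorem charFun_stdGaussian_orthogonal_split (he : ‖e‖ = 1) (t : E) :
    charFun (gaussianReal 0 1) (inner ℝ e t) * charFun (stdGaussian E) (t - inner ℝ e t • e) =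
      charFun (stdGaussian E) t := by
  have hnorm : ‖t - inner ℝ e t • e‖ ^ 2 = ‖t‖ ^ 2 - inner ℝ e t ^ 2 := by
    rw [norm_sub_sq_real, norm_smul, real_inner_smul_right, he, real_inner_comm t e, mul_one,
      Real.norm_eq_abs, sq_abs]
    ring
  rw [charFun_gaussianReal, charFun_stdGaussian, charFun_stdGaussian, ← Complex.exp_add,
    ← Complex.ofReal_pow ‖t - _‖, hnorm]
  congr 1
  push_cast
  ring

theorem stdGaussian_eq_map_prod (he : ‖e‖ = 1) :
    stdGaussian E = ((gaussianReal 0 1).prod (stdGaussian E)).map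
      fun p => p.1 • e + (p.2 - inner ℝ e p.2 • e) := by
  have hm : Measurable fun p : ℝ × E => p.1 • e + (p.2 - inner ℝ e p.2 • e) := by fun_prop
  have := Measure.isProbabilityMeasure_map (μ := (gaussianReal 0 1).prod (stdGaussian E))
    hm.aemeasurable
  refine Measure.ext_of_charFun (funext fun t => ?_)
  have hsplit (p : ℝ × E) :
      Complex.exp ((inner ℝ (p.1 • e + (p.2 - inner ℝ e p.2 • e)) t : ℝ) * Complex.I) =
      Complex.exp ((inner ℝ e t : ℝ) * p.1 * Complex.I) *
        Complex.exp ((inner ℝ p.2 (t - inner ℝ e t • e) : ℝ) * Complex.I) := by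
    rw [← Complex.exp_add, inner_add_left, inner_sub_left, inner_sub_right, real_inner_smul_left,
      real_inner_smul_left, real_inner_smul_right, real_inner_comm p.2 e]
    push_cast
    ring_nf
  rw [← charFun_stdGaussian_orthogonal_split he, charFun_apply_real, charFun_apply,
    ← integral_prod_mul, charFun_apply, integral_map hm.aemeasurable
    (Measurable.aestronglyMeasurable (by fun_prop))]
  exact integral_congr_ae (.of_forall fun p => (hsplit p).symm)

theorem stdGaussian_map_inner (w : E) :
    (stdGaussian E).map (fun f => inner ℝ f w) = gaussianReal 0 (‖w‖₊ ^ 2) := by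
  have h := IsGaussian.map_eq_gaussianReal (μ := stdGaussian E) (innerSL ℝ w)
  rw [integral_strongDual_stdGaussian, variance_dual_stdGaussian, innerSL_apply_norm,
    Real.toNNReal_pow (norm_nonneg w), norm_toNNReal] at h
  simp_rw [← h, real_inner_comm w]
  rfl

theorem indepFun_inner_stdGaussian {u w : E} (h : inner ℝ u w = 0) :
    IndepFun (fun f => inner ℝ f u) (fun f => inner ℝ f w) (stdGaussian E) := by
  have hid : HasGaussianLaw (id : E → E) (stdGaussian E) := by
    have : IsGaussian ((stdGaussian E).map id) := by rw [Measure.map_id]; infer_instance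
    exact IsGaussian.hasGaussianLaw
  have hcov := covarianceBilin_apply_eq_cov (μ := stdGaussian E) IsGaussian.memLp_two_id u w
  rw [covarianceBilin_stdGaussian, innerSL_apply_apply, h] at hcov
  simp_rw [real_inner_comm u, real_inner_comm w]
  exact (hid.map ((innerSL ℝ u).prod (innerSL ℝ w))).indepFun_of_covariance_eq_zero hcov.symm

theorem stdGaussian_submodule_eq_zero {V : Submodule ℝ E} (hV : V ≠ ⊤) :
    stdGaussian E (V : Set E) = 0 := by
  obtain ⟨w, hwV, hw⟩ := Submodule.exists_mem_ne_zero_of_ne_bot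
    (mt (Submodule.orthogonal_eq_bot_iff (K := V)).1 hV)
  have := nullSingletonClass_gaussianReal (μ := 0) (v := ‖w‖₊ ^ 2) (by simpa using hw)
  refine measure_mono_null (t := (fun f => inner ℝ f w) ⁻¹' {0})
    (fun f hf => Submodule.inner_right_of_mem_orthogonal hf hwV) ?_
  rw [← Measure.map_apply (by fun_prop) (measurableSet_singleton 0), stdGaussian_map_inner,
    measure_singleton]

theorem stdGaussian_eq_zero_of_ae_countable_line (he : ‖e‖ = 1) {S : Set E}
    (hS : MeasurableSet S) (h : ∀ᵐ f ∂stdGaussian E, {a : ℝ | f + a • e ∈ S}.Countable) :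
    stdGaussian E S = 0 := by
  have := nullSingletonClass_gaussianReal (μ := 0) (v := 1) one_ne_zero
  have hm : Measurable fun p : ℝ × E => p.1 • e + (p.2 - inner ℝ e p.2 • e) := by fun_prop
  rw [stdGaussian_eq_map_prod he, Measure.map_apply hm hS, Measure.prod_apply_symm (hm hS),
    lintegral_eq_zero_iff (measurable_measure_prodMk_right (hm hS))]
  filter_upwards [h] with f hf
  refine Countable.measure_zero ((hf.preimage (sub_left_injective (b := inner ℝ e f))).mono
    fun a ha => ?_) _
  have hline : f + (a - inner ℝ e f) • e = a • e + (f - inner ℝ e f • e) := by module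
  exact (congrArg (· ∈ S) hline).mpr ha

theorem lintegral_abs_inner_mul_gaussianPDF_inner {u w : E} (huw : inner ℝ u w = 0) :
    ∫⁻ f, ENNReal.ofReal |inner ℝ f w| * gaussianPDF 0 1 (inner ℝ f u) ∂stdGaussian E =
      ENNReal.ofReal (‖w‖ / (Real.pi * √(1 + ‖u‖ ^ 2))) := by
  have hind : IndepFun (fun f : E => ENNReal.ofReal |inner ℝ f w|)
      (fun f : E => gaussianPDF 0 1 (inner ℝ f u)) (stdGaussian E) :=
    (indepFun_inner_stdGaussian huw).symm.comp
      (φ := fun x : ℝ => ENNReal.ofReal |x|) (by fun_prop) (measurable_gaussianPDF _ _)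
  have hpdf : Measurable fun f : E => gaussianPDF 0 1 (inner ℝ f u) :=
    (measurable_gaussianPDF 0 1).comp (by fun_prop)
  rw [lintegral_mul_eq_lintegral_mul_lintegral_of_indepFun'' (by fun_prop) hpdf.aemeasurable hind,
    ← lintegral_map (f := fun x : ℝ => ENNReal.ofReal |x|) (by fun_prop) (by fun_prop),
    ← lintegral_map (measurable_gaussianPDF 0 1) (by fun_prop),
    stdGaussian_map_inner, stdGaussian_map_inner, lintegral_ofReal_abs_gaussianReal,
    lintegral_gaussianPDF_gaussianReal one_ne_zero, gaussianPDF,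
    ← ENNReal.ofReal_mul (by positivity), gaussianPDFReal_self]
  push_cast
  rw [Real.sqrt_div (by positivity), Real.sqrt_mul zero_le_two,
    Real.sqrt_sq (norm_nonneg w), Real.sqrt_mul (by positivity), Real.sqrt_mul zero_le_two]
  congr 1
  field_simp
  rw [Real.sq_sqrt Real.pi_pos.le]

theorem lintegral_abs_inner_deriv_mul_gaussianPDF (hγ : Differentiable ℝ γ) (he : ‖e‖ = 1)
    (heγ : ∀ θ, inner ℝ e (γ θ) = 1) (hr : ∀ θ, ‖γ θ‖ = r) (θ : ℝ) :
    ∫⁻ f, ENNReal.ofReal |inner ℝ f (deriv γ θ)| * gaussianPDF 0 1 (inner ℝ f (e - γ θ))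
        ∂stdGaussian E =
      ENNReal.ofReal (‖deriv γ θ‖ / (Real.pi * r)) := by
  have hinner : inner ℝ e (deriv γ θ) = 0 := by
    have h := (hasDerivAt_const θ e).inner ℝ (hγ θ).hasDerivAt
    simp only [heγ, inner_zero_left, add_zero] at h
    exact h.unique (hasDerivAt_const θ 1)
  have horth : inner ℝ (e - γ θ) (deriv γ θ) = 0 := by
    rw [inner_sub_left, hinner, inner_deriv_eq_zero_of_norm_eq hγ hr, sub_zero]
  have hnorm : 1 + ‖e - γ θ‖ ^ 2 = r ^ 2 := by
    rw [norm_sub_sq_real, he, heγ, hr]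
    ring
  rw [lintegral_abs_inner_mul_gaussianPDF_inner horth, hnorm,
    Real.sqrt_sq (hr θ ▸ norm_nonneg (γ θ))]

theorem lintegral_encard_zeros_inner_stdGaussian (hγ : Differentiable ℝ γ) (he : ‖e‖ = 1)
    (heγ : ∀ θ, inner ℝ e (γ θ) = 1) (hr : ∀ θ, ‖γ θ‖ = r) {s : Set ℝ} (hs : IsLocallyClosed s) :
    ∫⁻ f, ({θ ∈ s | inner ℝ f (γ θ) = 0}.encard : ℝ≥0∞) ∂stdGaussian E =
      ∫⁻ θ in s, ENNReal.ofReal (‖deriv γ θ‖ / (Real.pi * r)) := by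
  have hsm : MeasurableSet s := by
    obtain ⟨U, Z, hU, hZ, rfl⟩ := hs
    exact hU.measurableSet.inter hZ.measurableSet
  have hγc := hγ.continuous
  have hcount : Measurable fun f : E => ({θ ∈ s | inner ℝ f (γ θ) = 0}.encard : ℝ≥0∞) :=
    measurable_encard_zeros (F := fun f θ => inner ℝ f (γ θ)) (by fun_prop) hs
  have hres : Measurable fun p : ℝ × E => p.1 • e + (p.2 - inner ℝ e p.2 • e) := by fun_prop
  have hdensity : Measurable fun p : E × ℝ =>
      ENNReal.ofReal |inner ℝ p.1 (deriv γ p.2)| * gaussianPDF 0 1 (inner ℝ p.1 (e - γ p.2)) :=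
    .mul (by fun_prop) ((measurable_gaussianPDF 0 1).comp (by fun_prop))
  calc ∫⁻ f, ({θ ∈ s | inner ℝ f (γ θ) = 0}.encard : ℝ≥0∞) ∂stdGaussian E
      = ∫⁻ f, ∫⁻ a, ({θ ∈ s | inner ℝ (a • e + (f - inner ℝ e f • e)) (γ θ) = 0}.encard : ℝ≥0∞)
          ∂(gaussianReal 0 1) ∂stdGaussian E := by
        conv_lhs => rw [stdGaussian_eq_map_prod he]
        exact (lintegral_map hcount hres).trans (lintegral_prod_symm' _ (hcount.comp hres))
    _ = ∫⁻ f, ∫⁻ θ in s, ENNReal.ofReal |inner ℝ f (deriv γ θ)| *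
          gaussianPDF 0 1 (inner ℝ f (e - γ θ)) ∂volume ∂stdGaussian E :=
        lintegral_congr fun f => lintegral_encard_zeros_inner_resample hγ heγ hsm f
    _ = ∫⁻ θ in s, ∫⁻ f, ENNReal.ofReal |inner ℝ f (deriv γ θ)| *
          gaussianPDF 0 1 (inner ℝ f (e - γ θ)) ∂stdGaussian E :=
        lintegral_lintegral_swap hdensity.aemeasurable
    _ = ∫⁻ θ in s, ENNReal.ofReal (‖deriv γ θ‖ / (Real.pi * r)) :=
        lintegral_congr fun θ => lintegral_abs_inner_deriv_mul_gaussianPDF hγ he heγ hr θ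

end Gaussian

section Fourier

theorem differentiable_of_inner {E F : Type*} [NormedAddCommGroup E] [InnerProductSpace ℝ E]
    [FiniteDimensional ℝ E] [NormedAddCommGroup F] [NormedSpace ℝ F] {u : F → E}
    (h : ∀ f : E, Differentiable ℝ fun t => inner ℝ f (u t)) : Differentiable ℝ u := by
  have hsum := Differentiable.fun_sum (u := Finset.univ) fun i _ =>
    (h (stdOrthonormalBasis ℝ E i)).smul_const (stdOrthonormalBasis ℝ E i)
  simpa only [OrthonormalBasis.sum_repr'] using hsum

theorem sum_Icc_neg_sq (m : ℕ) :
    ∑ k ∈ Finset.Icc (-(m : ℤ)) m, (k : ℝ) ^ 2 = m * (m + 1) * (2 * m + 1) / 3 := by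
  induction m with
  | zero => simp
  | succ m ih =>
    rw [Nat.cast_succ, Finset.sum_Icc_succ_eq_add_endpoints, ih]
    push_cast
    ring

theorem integral_exp_int_mul (n : ℤ) :
    ∫ θ in (0 : ℝ)..2 * Real.pi, Complex.exp (n * θ * Complex.I) =
      if n = 0 then (2 * Real.pi : ℂ) else 0 := by
  split_ifs with hn
  · simp [hn]
  · have hc : (n * Complex.I : ℂ) ≠ 0 := mul_ne_zero (by exact_mod_cast hn) Complex.I_ne_zero
    have hperiod : Complex.exp (n * Complex.I * ((2 * Real.pi : ℝ) : ℂ)) = 1 := by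
      rw [← Complex.exp_int_mul_two_pi_mul_I n]
      push_cast
      ring_nf
    calc ∫ θ in (0 : ℝ)..2 * Real.pi, Complex.exp (n * θ * Complex.I)
        = ∫ θ in (0 : ℝ)..2 * Real.pi, Complex.exp (n * Complex.I * θ) := by
          simp only [mul_right_comm]
      _ = 0 := by rw [integral_exp_mul_complex hc, hperiod]; simp

theorem exp_mul_I_zpow (θ : ℝ) (k : ℤ) :
    Complex.exp (θ * Complex.I) ^ k = Complex.exp (k * θ * Complex.I) := by
  rw [← Complex.exp_int_mul, mul_assoc]

theorem conj_exp_int_mul (k : ℤ) (θ : ℝ) :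
    conj (Complex.exp (k * θ * Complex.I)) = Complex.exp (-k * θ * Complex.I) := by
  rw [← Complex.exp_conj]
  simp

theorem norm_exp_int_mul (k : ℤ) (θ : ℝ) : ‖Complex.exp (k * θ * Complex.I)‖ = 1 := by
  exact_mod_cast Complex.norm_exp_ofReal_mul_I (k * θ)

theorem integral_laurentEval_mul_exp (f : ℂ[T;T⁻¹]) (k : ℤ) :
    ∫ θ in (0 : ℝ)..2 * Real.pi,
      laurentEval f (Complex.exp (θ * Complex.I)) * Complex.exp (-k * θ * Complex.I) =
        2 * Real.pi * f.coeff k := by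
  have hmonomial (l : ℤ) (θ : ℝ) :
      f.coeff l * Complex.exp (θ * Complex.I) ^ l * Complex.exp (-k * θ * Complex.I) =
        f.coeff l * Complex.exp ((l - k : ℤ) * θ * Complex.I) := by
    rw [exp_mul_I_zpow, mul_assoc, ← Complex.exp_add]
    push_cast
    ring_nf
  simp only [laurentEval, Finsupp.sum, Finset.sum_mul, hmonomial]
  rw [intervalIntegral.integral_finsetSum fun l _ =>
    Continuous.intervalIntegrable (by fun_prop) _ _]
  simp only [intervalIntegral.integral_const_mul, integral_exp_int_mul, sub_eq_zero, mul_ite,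
    mul_zero, Finset.sum_ite_eq', Finsupp.mem_support_iff, ite_not]
  split_ifs with hk
  · rw [hk, mul_zero]
  · rw [mul_comm]

end Fourier

namespace realLaurent

section Coefficients

variable {m : ℕ}

theorem coeff_eq_zero (f : realLaurent m) {k : ℤ} (hk : k ∉ Finset.Icc (-(m : ℤ)) m) :
    f.1.coeff k = 0 := by
  by_contra hne
  exact hk (Finset.mem_Icc.2 (abs_le.1 (f.2.1 k (Finsupp.mem_support_iff.2 hne))))

theorem laurentEval_eq_sum (f : realLaurent m) (z : ℂ) :
    laurentEval f z = ∑ k ∈ Finset.Icc (-(m : ℤ)) m, f.1.coeff k * z ^ k := by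
  refine Finsupp.sum_of_support_subset _ (fun k hk => ?_) _ (by simp)
  by_contra h
  exact Finsupp.mem_support_iff.1 hk (coeff_eq_zero f h)

theorem ofReal_trig (f : realLaurent m) (θ : ℝ) :
    (trig f θ : ℂ) = laurentEval f (Complex.exp (θ * Complex.I)) :=
  Complex.ext rfl (f.2.2 _ (Complex.norm_exp_ofReal_mul_I θ)).symm

theorem trig_eq_re_sum (f : realLaurent m) (θ : ℝ) :
    trig f θ = (∑ k ∈ Finset.Icc (-(m : ℤ)) m,
      f.1.coeff k * Complex.exp (k * θ * Complex.I)).re := by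
  simp only [trig, laurentEval_eq_sum, exp_mul_I_zpow]

theorem inner_eq_sum (f g : realLaurent m) :
    inner ℝ f g = (∑ k ∈ Finset.Icc (-(m : ℤ)) m, f.1.coeff k * conj (g.1.coeff k)).re := by
  have hprod (θ : ℝ) : ((trig f θ * trig g θ : ℝ) : ℂ) =
      ∑ k ∈ Finset.Icc (-(m : ℤ)) m, conj (g.1.coeff k) *
        (laurentEval f (Complex.exp (θ * Complex.I)) * Complex.exp (-k * θ * Complex.I)) := by
    rw [Complex.ofReal_mul, ← Complex.conj_ofReal (trig g θ), ofReal_trig, ofReal_trig,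
      laurentEval_eq_sum g, map_sum, Finset.mul_sum]
    simp only [map_mul, exp_mul_I_zpow, conj_exp_int_mul, mul_left_comm]
  have hintegral : ((∫ θ in (0 : ℝ)..2 * Real.pi, trig f θ * trig g θ : ℝ) : ℂ) =
      (2 * Real.pi : ℝ) *
        ∑ k ∈ Finset.Icc (-(m : ℤ)) m, f.1.coeff k * conj (g.1.coeff k) := by
    have hcont := continuous_laurentEval_circle f.1
    rw [← intervalIntegral.integral_ofReal]
    simp only [hprod]
    rw [intervalIntegral.integral_finsetSum fun k _ =>
      Continuous.intervalIntegrable (by fun_prop) _ _, Finset.mul_sum]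
    refine Finset.sum_congr rfl fun k _ => ?_
    rw [intervalIntegral.integral_const_mul, integral_laurentEval_mul_exp]
    push_cast
    ring
  calc inner ℝ f g
      = 1 / (2 * Real.pi) * ∫ θ in (0 : ℝ)..2 * Real.pi, trig f θ * trig g θ := rfl
    _ = _ := by
      rw [← Complex.ofReal_re (∫ θ in (0 : ℝ)..2 * Real.pi, trig f θ * trig g θ), hintegral,
        Complex.re_ofReal_mul]
      field_simp

theorem norm_sq_eq_sum (f : realLaurent m) :
    ‖f‖ ^ 2 = ∑ k ∈ Finset.Icc (-(m : ℤ)) m, ‖f.1.coeff k‖ ^ 2 := by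
  rw [← real_inner_self_eq_norm_sq, inner_eq_sum, Complex.re_sum]
  refine Finset.sum_congr rfl fun k _ => ?_
  rw [Complex.mul_conj, Complex.ofReal_re, Complex.normSq_eq_norm_sq]

/-- The `k`-th coefficient, as a continuous real-linear functional. -/
noncomputable def coeffCLM (m : ℕ) (k : ℤ) : realLaurent m →L[ℝ] ℂ :=
  LinearMap.toContinuousLinearMap
    { toFun f := f.1.coeff k
      map_add' := by simp
      map_smul' := by simp }

@[simp]
theorem coeffCLM_apply (f : realLaurent m) (k : ℤ) : coeffCLM m k f = f.1.coeff k := rfl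

theorem mem_of_coeff_neg {f : ℂ[T;T⁻¹]} (hsupp : ∀ k ∈ f.coeff.support, |k| ≤ (m : ℤ))
    (hconj : ∀ k, f.coeff (-k) = conj (f.coeff k)) : f ∈ realLaurent m := by
  refine ⟨hsupp, fun z hz => Complex.conj_eq_iff_im.1 ?_⟩
  have hsum : laurentEval f z = ∑ k ∈ Finset.Icc (-(m : ℤ)) m, f.coeff k * z ^ k :=
    Finsupp.sum_of_support_subset _ (fun k hk => Finset.mem_Icc.2 (abs_le.1 (hsupp k hk))) _
      (by simp)
  rw [hsum, map_sum]
  refine Finset.sum_nbij' Neg.neg Neg.neg ?_ ?_ (by simp) (by simp) fun k _ => ?_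
  · intro k hk; simp only [Finset.mem_Icc] at hk ⊢; omega
  · intro k hk; simp only [Finset.mem_Icc] at hk ⊢; omega
  · rw [hconj, map_mul, map_zpow₀, zpow_neg, ← inv_zpow, Complex.inv_eq_conj hz]

/-- The constant Laurent polynomial `1`. -/
noncomputable def one (m : ℕ) : realLaurent m :=
  ⟨AddMonoidAlgebra.ofCoeff (Finsupp.single 0 1), mem_of_coeff_neg
    (fun k hk => by
      obtain rfl := Finset.mem_singleton.1 (Finsupp.support_single_subset hk)
      simp)
    (fun k => by simp [Finsupp.single_apply, apply_ite conj, eq_comm])⟩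

theorem coeff_one (k : ℤ) : (one m).1.coeff k = if k = 0 then 1 else 0 := by
  simp only [one, AddMonoidAlgebra.coeff_ofCoeff, Finsupp.single_apply, eq_comm]

theorem laurentEval_one (z : ℂ) : laurentEval (one m) z = 1 := by
  rw [laurentEval, one, AddMonoidAlgebra.coeff_ofCoeff, Finsupp.sum_single_index (zero_mul _),
    zpow_zero, one_mul]

theorem norm_one : ‖one m‖ = 1 := by
  have h : ‖one m‖ ^ 2 = 1 := by
    rw [norm_sq_eq_sum]
    simp [coeff_one, apply_ite]
  exact (pow_eq_one_iff_of_nonneg (norm_nonneg _) two_ne_zero).1 h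

end Coefficients

section Kernel

variable {m : ℕ}

/-- The reproducing kernel at the angle `θ`: the Dirichlet kernel `∑ e⁻ⁱᵏᶿ zᵏ`, `|k| ≤ m`, whose
scalar product with `f` is `f(eⁱᶿ)`. -/
noncomputable def kernel (m : ℕ) (θ : ℝ) : realLaurent m :=
  ⟨AddMonoidAlgebra.ofCoeff (Finsupp.indicator (Finset.Icc (-(m : ℤ)) m)
      fun k _ => Complex.exp (-k * θ * Complex.I)), mem_of_coeff_neg
    (fun k hk => abs_le.2 (Finset.mem_Icc.1 (Finsupp.support_indicator_subset _ _ hk)))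
    (fun k => by
      have hk : -k ∈ Finset.Icc (-(m : ℤ)) m ↔ k ∈ Finset.Icc (-(m : ℤ)) m := by
        simp only [Finset.mem_Icc]; omega
      have hexp := conj_exp_int_mul (-k) θ
      push_cast at hexp
      simp only [Finsupp.indicator_apply, dite_eq_ite, hk, apply_ite conj, map_zero, hexp,
        Int.cast_neg])⟩

theorem coeff_kernel {k : ℤ} (hk : k ∈ Finset.Icc (-(m : ℤ)) m) (θ : ℝ) :
    (kernel m θ).1.coeff k = Complex.exp (-k * θ * Complex.I) := by
  simp only [kernel, AddMonoidAlgebra.coeff_ofCoeff, Finsupp.indicator_of_mem hk]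

theorem inner_kernel (f : realLaurent m) (θ : ℝ) : inner ℝ f (kernel m θ) = trig f θ := by
  rw [inner_eq_sum, trig_eq_re_sum]
  congr 1
  refine Finset.sum_congr rfl fun k hk => ?_
  rw [coeff_kernel hk, ← conj_exp_int_mul, Complex.conj_conj]

theorem inner_one_kernel (θ : ℝ) : inner ℝ (one m) (kernel m θ) = 1 := by
  rw [inner_kernel, trig, laurentEval_one, Complex.one_re]

theorem norm_kernel (θ : ℝ) : ‖kernel m θ‖ = √(2 * m + 1) := by
  have hcoeff : ∀ k ∈ Finset.Icc (-(m : ℤ)) m, ‖(kernel m θ).1.coeff k‖ ^ 2 = 1 := fun k hk => by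
    rw [coeff_kernel hk, ← Int.cast_neg, norm_exp_int_mul, one_pow]
  have hcard : (Finset.Icc (-(m : ℤ)) m).card = 2 * m + 1 := by rw [Int.card_Icc]; omega
  rw [← Real.sqrt_sq (norm_nonneg (kernel m θ)), norm_sq_eq_sum, Finset.sum_congr rfl hcoeff,
    Finset.sum_const, hcard, nsmul_one]
  push_cast
  rfl

theorem differentiable_kernel : Differentiable ℝ (kernel m) := by
  refine differentiable_of_inner fun f => ?_
  simp only [inner_kernel, trig_eq_re_sum]
  refine Complex.reCLM.differentiable.comp ?_
  fun_prop

theorem coeff_deriv_kernel {k : ℤ} (hk : k ∈ Finset.Icc (-(m : ℤ)) m) (θ : ℝ) :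
    (deriv (kernel m) θ).1.coeff k = -k * Complex.I * Complex.exp (-k * θ * Complex.I) := by
  have hcoeff : HasDerivAt (fun t : ℝ => Complex.exp (-k * t * Complex.I))
      ((deriv (kernel m) θ).1.coeff k) θ := by
    simpa only [Function.comp_def, coeffCLM_apply, coeff_kernel hk] using
      (coeffCLM m k).hasFDerivAt.comp_hasDerivAt θ (differentiable_kernel θ).hasDerivAt
  have hexp : HasDerivAt (fun t : ℝ => Complex.exp (-k * t * Complex.I))
      (Complex.exp (-k * θ * Complex.I) * (-k * 1 * Complex.I)) θ :=
    (((hasDerivAt_id θ).ofReal_comp.const_mul (-k : ℂ)).mul_const Complex.I).cexp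
  rw [hcoeff.unique hexp]
  ring

theorem norm_deriv_kernel (θ : ℝ) :
    ‖deriv (kernel m) θ‖ = √(m * (m + 1) * (2 * m + 1) / 3) := by
  have hcoeff : ∀ k ∈ Finset.Icc (-(m : ℤ)) m,
      ‖(deriv (kernel m) θ).1.coeff k‖ ^ 2 = (k : ℝ) ^ 2 := fun k hk => by
    rw [coeff_deriv_kernel hk, ← Int.cast_neg, norm_mul, norm_exp_int_mul]
    simp
  rw [← Real.sqrt_sq (norm_nonneg (deriv (kernel m) θ)), norm_sq_eq_sum,
    Finset.sum_congr rfl hcoeff, sum_Icc_neg_sq]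

theorem lintegral_encard_trig_zeros (m : ℕ) :
    ∫⁻ f : realLaurent m, ({θ ∈ Ico 0 (2 * Real.pi) | trig f θ = 0}.encard : ℝ≥0∞)
      ∂randomLaurent m = ENNReal.ofReal (2 * √(m * (m + 1) / 3)) := by
  have hspeed : √(m * (m + 1) * (2 * m + 1) / 3) / (Real.pi * √(2 * m + 1)) * (2 * Real.pi) =
      2 * √(m * (m + 1) / 3) := by
    rw [mul_div_right_comm, Real.sqrt_mul (by positivity)]
    field_simp
  simp only [← inner_kernel]
  rw [lintegral_encard_zeros_inner_stdGaussian differentiable_kernel norm_one inner_one_kernel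
    norm_kernel isLocallyClosed_Ico]
  simp only [norm_deriv_kernel, setLIntegral_const, Real.volume_Ico, sub_zero]
  rw [← ENNReal.ofReal_mul (by positivity), hspeed]

end Kernel

end realLaurent

section ShiftedPolynomial

variable {m : ℕ} {c : ℤ → ℂ}

/-- The polynomial `zᵐ ∑ cₖ zᵏ`, the sum over `|k| ≤ m`: clearing the denominators of a Laurent
polynomial reduces counting its roots to the fundamental theorem of algebra. -/
noncomputable def shiftedPolynomial (m : ℕ) (c : ℤ → ℂ) : Polynomial ℂ :=
  ∑ j ∈ Finset.range (2 * m + 1), Polynomial.monomial j (c (j - m))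

theorem coeff_shiftedPolynomial (m : ℕ) (c : ℤ → ℂ) (j : ℕ) :
    (shiftedPolynomial m c).coeff j = if j ≤ 2 * m then c (j - m) else 0 := by
  simp only [shiftedPolynomial, Polynomial.finsetSum_coeff, Polynomial.coeff_monomial,
    Finset.sum_ite_eq', Finset.mem_range, Nat.lt_succ_iff]

theorem eval_shiftedPolynomial (m : ℕ) (c : ℤ → ℂ) {z : ℂ} (hz : z ≠ 0) :
    (shiftedPolynomial m c).eval z = z ^ m * ∑ k ∈ Finset.Icc (-(m : ℤ)) m, c k * z ^ k := by
  rw [shiftedPolynomial, Polynomial.eval_finsetSum, Finset.mul_sum]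
  refine Finset.sum_bij' (fun j _ => (j : ℤ) - m) (fun k _ => (k + m).toNat) ?_ ?_ ?_ ?_ ?_
  · intro j hj; simp only [Finset.mem_range, Finset.mem_Icc] at hj ⊢; omega
  · intro k hk; simp only [Finset.mem_range, Finset.mem_Icc] at hk ⊢; omega
  · intro j _; simp
  · intro k hk; simp only [Finset.mem_Icc] at hk; omega
  · intro j _
    rw [Polynomial.eval_monomial, zpow_sub₀ hz, zpow_natCast, zpow_natCast]
    field_simp

theorem eval_zero_shiftedPolynomial (m : ℕ) (c : ℤ → ℂ) :
    (shiftedPolynomial m c).eval 0 = c (-m) := by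
  rw [← Polynomial.coeff_zero_eq_eval_zero, coeff_shiftedPolynomial, if_pos (Nat.zero_le _),
    Nat.cast_zero, zero_sub]

theorem coeff_two_mul_shiftedPolynomial (m : ℕ) (c : ℤ → ℂ) :
    (shiftedPolynomial m c).coeff (2 * m) = c m := by
  rw [coeff_shiftedPolynomial, if_pos le_rfl]
  push_cast
  rw [two_mul, add_sub_cancel_right]

theorem shiftedPolynomial_ne_zero (hc : c m ≠ 0) : shiftedPolynomial m c ≠ 0 := fun h =>
  hc (by rw [← coeff_two_mul_shiftedPolynomial m c, h, Polynomial.coeff_zero])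

theorem natDegree_shiftedPolynomial (hc : c m ≠ 0) :
    (shiftedPolynomial m c).natDegree = 2 * m := by
  refine Polynomial.natDegree_eq_of_le_of_coeff_ne_zero
    (Polynomial.natDegree_le_iff_coeff_eq_zero.2 fun j hj => ?_)
    (by rwa [coeff_two_mul_shiftedPolynomial])
  rw [coeff_shiftedPolynomial, if_neg (not_le.2 hj)]

theorem finite_zeros_sum_zpow (hc : c m ≠ 0) :
    {z : ℂ | z ≠ 0 ∧ ∑ k ∈ Finset.Icc (-(m : ℤ)) m, c k * z ^ k = 0}.Finite := by
  refine (Polynomial.finite_setOfPred_isRoot (shiftedPolynomial_ne_zero hc)).subset ?_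
  rintro z ⟨hz, hsum⟩
  rw [mem_ofPred_eq, Polynomial.IsRoot, eval_shiftedPolynomial m c hz, hsum, mul_zero]

end ShiftedPolynomial

section SimpleRoots

variable {f : ℂ[T;T⁻¹]}

/-- Every root in `ℂ ∖ 0` is simple, so that counting roots once or with multiplicity makes no
difference. -/
def HasSimpleRoots (f : ℂ[T;T⁻¹]) : Prop :=
  ∀ z ∈ laurentRoots f, deriv (laurentEval f) z ≠ 0

theorem analyticAt_laurentEval (f : ℂ[T;T⁻¹]) {z : ℂ} (hz : z ≠ 0) :
    AnalyticAt ℂ (laurentEval f) z :=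
  Finset.analyticAt_fun_sum _ fun _ _ => analyticAt_const.mul (analyticAt_id.zpow hz)

theorem HasSimpleRoots.countRoots_eq_ncard (hf : HasSimpleRoots f) {R : Set ℂ}
    (hR : R ⊆ laurentRoots f) (c : RootCounting) : countRoots f R c = R.ncard := by
  cases c with
  | distinct => rfl
  | withMultiplicity =>
    have horder : ∀ z ∈ R, analyticOrderNatAt (laurentEval f) z = 1 := fun z hz => by
      rw [analyticOrderNatAt,
        (analyticAt_laurentEval f (hR hz).1).analyticOrderAt_eq_one_of_zero_deriv_ne_zero
          (hR hz).2 (hf z (hR hz)), ENat.toNat_one]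
    rw [countRoots, finsum_mem_congr rfl horder, finsum_one]

end SimpleRoots

namespace realLaurent

section RootCount

variable {m : ℕ} {f : realLaurent m}

theorem eval_shiftedPolynomial_coeff (f : realLaurent m) {z : ℂ} (hz : z ≠ 0) :
    (shiftedPolynomial m f.1.coeff).eval z = z ^ m * laurentEval f z := by
  rw [eval_shiftedPolynomial m _ hz, laurentEval_eq_sum]

theorem isRoot_shiftedPolynomial_iff (hf : f.1.coeff (-m) ≠ 0) {z : ℂ} :
    (shiftedPolynomial m f.1.coeff).IsRoot z ↔ z ∈ laurentRoots f := by
  rw [Polynomial.IsRoot.def]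
  rcases eq_or_ne z 0 with rfl | hz
  · simp [eval_zero_shiftedPolynomial, hf, laurentRoots]
  · simp [eval_shiftedPolynomial_coeff f hz, hz, laurentRoots]

theorem derivative_eval_shiftedPolynomial {z : ℂ} (hz : z ∈ laurentRoots f) :
    (shiftedPolynomial m f.1.coeff).derivative.eval z = z ^ m * deriv (laurentEval f) z := by
  have hprod : HasDerivAt (fun w => w ^ m * laurentEval f w)
      (m * z ^ (m - 1) * laurentEval f z + z ^ m * deriv (laurentEval f) z) z :=
    (hasDerivAt_pow m z).mul (analyticAt_laurentEval f.1 hz.1).differentiableAt.hasDerivAt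
  have heval : (fun w => (shiftedPolynomial m f.1.coeff).eval w) =ᶠ[𝓝 z]
      fun w => w ^ m * laurentEval f w := by
    filter_upwards [isOpen_ne.mem_nhds hz.1] with w hw using eval_shiftedPolynomial_coeff f hw
  rw [← Polynomial.deriv, heval.deriv_eq, hprod.deriv, hz.2, mul_zero, zero_add]

theorem nodup_roots_shiftedPolynomial (htop : f.1.coeff m ≠ 0) (hbot : f.1.coeff (-m) ≠ 0)
    (hf : HasSimpleRoots f.1) : (shiftedPolynomial m f.1.coeff).roots.Nodup := by
  rw [Multiset.nodup_iff_count_le_one]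
  intro z
  rw [Polynomial.count_roots]
  by_contra! hmultiple
  obtain ⟨hroot, hderiv⟩ := (Polynomial.one_lt_rootMultiplicity_iff_isRoot
    (shiftedPolynomial_ne_zero htop)).1 hmultiple
  have hz := (isRoot_shiftedPolynomial_iff hbot).1 hroot
  rw [Polynomial.IsRoot.def, derivative_eval_shiftedPolynomial hz] at hderiv
  exact mul_ne_zero (pow_ne_zero m hz.1) (hf z hz) hderiv

theorem ncard_laurentRoots (htop : f.1.coeff m ≠ 0) (hbot : f.1.coeff (-m) ≠ 0)
    (hf : HasSimpleRoots f.1) : (laurentRoots f).ncard = 2 * m := by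
  have hset : laurentRoots f = ((shiftedPolynomial m f.1.coeff).roots.toFinset : Set ℂ) := by
    ext z
    rw [Finset.mem_coe, Multiset.mem_toFinset,
      Polynomial.mem_roots (shiftedPolynomial_ne_zero htop), isRoot_shiftedPolynomial_iff hbot]
  rw [hset, ncard_coe_finset,
    Multiset.toFinset_card_of_nodup (nodup_roots_shiftedPolynomial htop hbot hf),
    IsAlgClosed.card_roots_eq_natDegree, natDegree_shiftedPolynomial htop]

theorem laurentRealRoots_eq_image (f : realLaurent m) :
    laurentRealRoots f = circleMap 0 1 '' {θ ∈ Ico 0 (2 * Real.pi) | trig f θ = 0} := by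
  have htrig (θ : ℝ) : laurentEval f (circleMap 0 1 θ) = 0 ↔ trig f θ = 0 := by
    rw [← Complex.ofReal_eq_zero, ofReal_trig, circleMap_zero, Complex.ofReal_one, one_mul]
  ext z
  constructor
  · rintro ⟨⟨-, hz⟩, hz1⟩
    obtain ⟨t, rfl⟩ : z ∈ range (circleMap 0 1) := by
      rw [range_circleMap]
      simpa using hz1
    obtain ⟨θ, hθ, htθ⟩ := (periodic_circleMap 0 1).exists_mem_Ico₀ Real.two_pi_pos t
    rw [htθ] at hz
    exact ⟨θ, ⟨hθ, (htrig θ).1 hz⟩, htθ.symm⟩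
  · rintro ⟨θ, ⟨-, hθ⟩, rfl⟩
    exact ⟨⟨circleMap_ne_center one_ne_zero, (htrig θ).2 hθ⟩, by simp⟩

theorem encard_laurentRealRoots (f : realLaurent m) :
    (laurentRealRoots f).encard = {θ ∈ Ico 0 (2 * Real.pi) | trig f θ = 0}.encard := by
  rw [laurentRealRoots_eq_image, InjOn.encard_image]
  exact (injOn_circleMap_of_abs_sub_le' one_ne_zero (by simp)).mono fun θ hθ => hθ.1

end RootCount

section AlmostSurelySimple

variable {m : ℕ}

theorem ae_coeff_ne_zero {k : ℤ} (hk : k ∈ Finset.Icc (-(m : ℤ)) m) :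
    ∀ᵐ f ∂randomLaurent m, f.1.coeff k ≠ 0 := by
  refine measure_mono_null (fun f hf => ?_)
    (stdGaussian_submodule_eq_zero (V := LinearMap.ker (coeffCLM m k).toLinearMap) fun h => ?_)
  · simpa using hf
  · have hkernel : kernel m 0 ∈ LinearMap.ker (coeffCLM m k).toLinearMap := h ▸ Submodule.mem_top
    simp [coeff_kernel hk] at hkernel

theorem deriv_laurentEval (f : realLaurent m) {z : ℂ} (hz : z ≠ 0) :
    deriv (laurentEval f) z =
      z⁻¹ * ∑ k ∈ Finset.Icc (-(m : ℤ)) m, k * f.1.coeff k * z ^ k := by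
  have hfun : laurentEval f.1 = fun z => ∑ k ∈ Finset.Icc (-(m : ℤ)) m, f.1.coeff k * z ^ k :=
    funext (laurentEval_eq_sum f)
  have hderiv : HasDerivAt (laurentEval f.1)
      (∑ k ∈ Finset.Icc (-(m : ℤ)) m, f.1.coeff k * (k * z ^ (k - 1))) z := by
    rw [hfun]
    exact HasDerivAt.fun_sum fun k _ => (hasDerivAt_zpow k z (Or.inl hz)).const_mul _
  rw [hderiv.deriv, Finset.mul_sum]
  refine Finset.sum_congr rfl fun k _ => ?_
  rw [zpow_sub_one₀ hz]
  ring

theorem finite_setOf_deriv_laurentEval_eq_zero (hm : m ≠ 0) {f : realLaurent m}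
    (hf : f.1.coeff m ≠ 0) : {z | z ≠ 0 ∧ deriv (laurentEval f) z = 0}.Finite := by
  refine (finite_zeros_sum_zpow (m := m) (c := fun k => k * f.1.coeff k)
    (mul_ne_zero (by exact_mod_cast hm) hf)).subset ?_
  rintro z ⟨hz, hderiv⟩
  rw [deriv_laurentEval f hz] at hderiv
  exact ⟨hz, (mul_eq_zero.1 hderiv).resolve_left (inv_ne_zero hz)⟩

theorem measurableSet_setOf_not_hasSimpleRoots (m : ℕ) :
    MeasurableSet {f : realLaurent m | ¬ HasSimpleRoots f.1} := by
  have hcoeff (k : ℤ) : ContinuousOn (fun p : realLaurent m × ℂ => p.1.1.coeff k)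
      (univ ×ˢ {0}ᶜ) := ((coeffCLM m k).continuous.comp continuous_fst).continuousOn
  have hzpow (k : ℤ) : ContinuousOn (fun p : realLaurent m × ℂ => p.2 ^ k) (univ ×ˢ {0}ᶜ) :=
    continuousOn_snd.zpow₀ k fun p hp => Or.inl hp.2
  have hderiv : ContinuousOn (fun p : realLaurent m × ℂ => deriv (laurentEval p.1) p.2)
      (univ ×ˢ {0}ᶜ) :=
    ((continuousOn_snd.inv₀ fun _ hp => hp.2).mul <| continuousOn_finsetSum _ fun k _ =>
      (continuousOn_const.mul (hcoeff k)).mul (hzpow k)).congr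
        fun p hp => deriv_laurentEval p.1 hp.2
  have heval : ContinuousOn (fun p : realLaurent m × ℂ => laurentEval p.1 p.2) (univ ×ˢ {0}ᶜ) :=
    (continuousOn_finsetSum _ fun k _ => (hcoeff k).mul (hzpow k)).congr
      fun p _ => laurentEval_eq_sum p.1 p.2
  have hset : {f : realLaurent m | ¬ HasSimpleRoots f.1} =
      {f : realLaurent m |
        ∃ z ∈ ({0}ᶜ : Set ℂ), (laurentEval f z, deriv (laurentEval f) z) = 0} := by
    ext f
    simp [HasSimpleRoots, laurentRoots]
  rw [hset]
  exact measurableSet_setOf_exists_mem_isSigmaCompact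
    (F := fun (f : realLaurent m) z => (laurentEval f z, deriv (laurentEval f) z))
    (isSigmaCompact_of_isLocallyClosed isOpen_compl_singleton.isLocallyClosed)
    (heval.prodMk hderiv) 0

theorem countable_setOf_add_smul_one_not_hasSimpleRoots (hm : m ≠ 0) {f : realLaurent m}
    (hf : f.1.coeff m ≠ 0) : {a : ℝ | ¬ HasSimpleRoots (f + a • one m).1}.Countable := by
  have heval (a : ℝ) (z : ℂ) : laurentEval (f + a • one m).1 z = laurentEval f z + a := by
    rw [Submodule.coe_add, laurentEval_add, Submodule.coe_smul, laurentEval_smul,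
      laurentEval_one, mul_one]
  refine ((finite_setOf_deriv_laurentEval_eq_zero hm hf).image
    fun z => -(laurentEval f z).re).countable.mono fun a ha => ?_
  obtain ⟨z, hz, hderiv⟩ : ∃ z ∈ laurentRoots (f + a • one m).1,
      deriv (laurentEval (f + a • one m).1) z = 0 := by
    simpa [HasSimpleRoots] using ha
  rw [funext (heval a), deriv_add_const] at hderiv
  have hroot := hz.2
  rw [heval] at hroot
  refine ⟨z, ⟨hz.1, hderiv⟩, ?_⟩
  simp [eq_neg_of_add_eq_zero_left hroot]

theorem ae_hasSimpleRoots (m : ℕ) : ∀ᵐ f : realLaurent m ∂randomLaurent m, HasSimpleRoots f.1 := by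
  have htop : ∀ᵐ f ∂randomLaurent m, f.1.coeff m ≠ 0 := ae_coeff_ne_zero (by simp)
  rcases eq_or_ne m 0 with rfl | hm
  · filter_upwards [htop] with f hf z hz
    exact absurd (by simpa [laurentEval_eq_sum] using hz.2) hf
  · exact stdGaussian_eq_zero_of_ae_countable_line norm_one
      (measurableSet_setOf_not_hasSimpleRoots m)
      (htop.mono fun f hf => countable_setOf_add_smul_one_not_hasSimpleRoots hm hf)

end AlmostSurelySimple

section Expectation

variable {m : ℕ}

theorem measurable_encard_trig_zeros (m : ℕ) : Measurable fun f : realLaurent m =>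
    ({θ ∈ Ico 0 (2 * Real.pi) | trig f θ = 0}.encard : ℝ≥0∞) := by
  have hkernel : Continuous (kernel m) := differentiable_kernel.continuous
  refine measurable_encard_zeros (F := fun (f : realLaurent m) θ => trig f θ) ?_ isLocallyClosed_Ico
  simp only [← inner_kernel]
  fun_prop

theorem countRoots_laurentRealRoots_ae_eq (m : ℕ) (c : RootCounting) :
    (fun f : realLaurent m => (countRoots f (laurentRealRoots f) c : ℝ)) =ᵐ[randomLaurent m]
      fun f => ({θ ∈ Ico 0 (2 * Real.pi) | trig f θ = 0}.encard : ℝ≥0∞).toReal := by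
  filter_upwards [ae_hasSimpleRoots m] with f hf
  rw [hf.countRoots_eq_ncard fun z hz => hz.1, ← encard_laurentRealRoots, ncard_def]
  cases (laurentRealRoots f.1).encard <;> simp

theorem integrable_countRoots_laurentRealRoots (m : ℕ) (c : RootCounting) :
    Integrable (fun f : realLaurent m => (countRoots f (laurentRealRoots f) c : ℝ))
      (randomLaurent m) := by
  refine (integrable_toReal_of_lintegral_ne_top
    (measurable_encard_trig_zeros m).aemeasurable ?_).congr
      (countRoots_laurentRealRoots_ae_eq m c).symm
  rw [lintegral_encard_trig_zeros]
  exact ENNReal.ofReal_ne_top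

theorem integral_countRoots_laurentRealRoots (m : ℕ) (c : RootCounting) :
    ∫ f : realLaurent m, (countRoots f (laurentRealRoots f) c : ℝ) ∂randomLaurent m =
      2 * √(m * (m + 1) / 3) := by
  have hmeas := measurable_encard_trig_zeros m
  have hlint := lintegral_encard_trig_zeros m
  rw [integral_congr_ae (countRoots_laurentRealRoots_ae_eq m c),
    integral_toReal hmeas.aemeasurable (ae_lt_top hmeas (hlint ▸ ENNReal.ofReal_ne_top)), hlint,
    ENNReal.toReal_ofReal (by positivity)]

theorem ae_countRoots_laurentRoots_eq (m : ℕ) (c : RootCounting) :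
    ∀ᵐ f : realLaurent m ∂randomLaurent m, countRoots f (laurentRoots f) c = 2 * m := by
  filter_upwards [ae_hasSimpleRoots m, ae_coeff_ne_zero (m := m) (k := m) (by simp),
    ae_coeff_ne_zero (m := m) (k := -m) (by simp)] with f hf htop hbot
  rw [hf.countRoots_eq_ncard subset_rfl, ncard_laurentRoots htop hbot hf]

theorem realRootProbability_eq (hm : 1 ≤ m) (c : RootCounting) :
    realRootProbability m c = √((m + 1) / (3 * m)) := by
  have hm' : (0 : ℝ) < m := by exact_mod_cast hm
  have hquot : (fun f : realLaurent m => (countRoots f (laurentRealRoots f) c : ℝ) /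
      countRoots f (laurentRoots f) c) =ᵐ[randomLaurent m]
      fun f => (countRoots f (laurentRealRoots f) c : ℝ) / (2 * m) := by
    filter_upwards [ae_countRoots_laurentRoots_eq m c] with f hf
    rw [hf, Nat.cast_mul, Nat.cast_ofNat]
  calc realRootProbability m c
      = 2 * √(m * (m + 1) / 3) / (2 * m) := by
        rw [realRootProbability, integral_congr_ae hquot, integral_div,
          integral_countRoots_laurentRealRoots]
    _ = √(m ^ 2 * ((m + 1) / (3 * m))) / m := by
        rw [mul_div_mul_left _ _ two_ne_zero]
        congr 2
        field_simp
    _ = √((m + 1) / (3 * m)) := by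
        rw [Real.sqrt_mul (by positivity), Real.sqrt_sq hm'.le, mul_div_cancel_left₀ _ hm'.ne']

theorem tendsto_sqrt_succ_div_three_mul :
    Filter.Tendsto (fun m : ℕ => √(((m : ℝ) + 1) / (3 * m))) Filter.atTop (𝓝 (1 / √3)) := by
  have hlim : Filter.Tendsto (fun m : ℕ => √((1 + 1 / (m : ℝ)) / 3)) Filter.atTop
      (𝓝 √((1 + 0) / 3)) :=
    ((tendsto_one_div_atTop_nhds_zero_nat.const_add 1).div_const 3).sqrt
  rw [add_zero, Real.sqrt_div zero_le_one, Real.sqrt_one] at hlim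
  refine hlim.congr' ?_
  filter_upwards [Filter.eventually_ne_atTop 0] with m hm
  field_simp

end Expectation

end realLaurent

theorem theorem2 (c : RootCounting) :
    (∀ m : ℕ,
      MeasureTheory.Integrable
        (fun f : realLaurent m => (countRoots f (laurentRealRoots f) c : ℝ)) (randomLaurent m) ∧
      ∫ f : realLaurent m, (countRoots f (laurentRealRoots f) c : ℝ) ∂randomLaurent m =
        2 * Real.sqrt ((m : ℝ) * (m + 1) / 3)) ∧
    (∀ m : ℕ, 1 ≤ m → realRootProbability m c = Real.sqrt (((m : ℝ) + 1) / (3 * m))) ∧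
    Filter.Tendsto (fun m : ℕ => realRootProbability m c) Filter.atTop
      (nhds (1 / Real.sqrt 3)) := by
  refine ⟨fun m => ⟨realLaurent.integrable_countRoots_laurentRealRoots m c,
    realLaurent.integral_countRoots_laurentRealRoots m c⟩,
    fun m hm => realLaurent.realRootProbability_eq hm c, ?_⟩
  refine realLaurent.tendsto_sqrt_succ_div_three_mul.congr' ?_
  filter_upwards [Filter.eventually_ge_atTop 1] with m hm
  exact (realLaurent.realRootProbability_eq hm c).symm
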